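/- Let $n\ge 0$ be an integer and $[n]=\{1,\dots,n\}$. For complex $n\times n$ matrices $A,B$ and $I\subseteq[n]$ let $\phi(A,B)_I$ be the determinant of the $n\times n$ matrix whose $j$-th column is the $j$-th column of $A$ if $j\in I$ and the $j$-th column of $B$ if $j\notin I$. This defines the projective principal minor map $\phi:\mathbb{C}^{n\times n}\times\mathbb{C}^{n\times n}\to\mathbb{C}^{2^n}$, $(A,B)\mapsto(\phi(A,B)_I)_{I\subseteq[n]}$. Let $$\mathcal{V}_n=\bigl\{[\phi(A,B)] : A,B\in\mathbb{C}^{n\times n},\ \phi(A,B)\neq 0\bigr\}\subseteq\mathbb{P}^{2^n-1}$$ be its image in complex projective space with homogeneous coordinates indexed by the subsets of $[n]$. Then $\mathcal{V}_n$ is closed in the Zariski topology of $\mathbb{P}^{2^n-1}$, i.e. it is the common zero set of a set of homogeneous polynomials, and it is irreducible (non-empty and not the union of two proper relatively closed subsets). That is, $\mathcal{V}_n$ is an irreducible projective variety. -/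

import Mathlib

open scoped LinearAlgebra.Projectivization Topology

/-- The zero locus in the projective space of `σ → K` (homogeneous coordinates indexed by `σ`) of a
set of polynomials; it is used only for sets of homogeneous polynomials, for which the vanishing
at a point does not depend on the representative (see `projectiveZeroLocus_mk`). -/
def projectiveZeroLocus {K σ : Type*} [Field K] (S : Set (MvPolynomial σ K)) :
    Set (ℙ K (σ → K)) :=
  {x | ∀ p ∈ S, MvPolynomial.eval x.rep p = 0}

/-- A projective algebraic set: the common zeros of a set of homogeneous polynomials. -/
def IsProjectiveAlgebraicSet {K σ : Type*} [Field K] (Z : Set (ℙ K (σ → K))) : Prop :=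
  ∃ S : Set (MvPolynomial σ K), (∀ p ∈ S, ∃ d : ℕ, p.IsHomogeneous d) ∧ Z = projectiveZeroLocus S

theorem projectiveZeroLocus_mk {K σ : Type*} [Field K] {S : Set (MvPolynomial σ K)}
    (hS : ∀ p ∈ S, ∃ d : ℕ, p.IsHomogeneous d) (v : σ → K) (hv : v ≠ 0) :
    Projectivization.mk K v hv ∈ projectiveZeroLocus S ↔ ∀ p ∈ S, MvPolynomial.eval v p = 0 := by
  obtain ⟨a, ha⟩ := Projectivization.exists_smul_eq_mk_rep K v hv
  refine forall₂_congr fun p hp => ?_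
  obtain ⟨d, hd⟩ := hS p hp
  have key : MvPolynomial.eval (a • v) p = (a : K) ^ d * MvPolynomial.eval v p :=
    by
    rw [MvPolynomial.eval_eq, MvPolynomial.eval_eq, Finset.mul_sum]
    refine Finset.sum_congr rfl fun m hm => ?_
    have hdeg : ∑ i ∈ m.support, m i = d := by
      rw [← hd.degree_eq_sum_deg_support hm]
    have hpow : ∏ i ∈ m.support, (a • v) i ^ m i = (a : K) ^ d * ∏ i ∈ m.support, v i ^ m i := by
      rw [← hdeg, ← Finset.prod_pow_eq_pow_sum, ← Finset.prod_mul_distrib]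
      exact Finset.prod_congr rfl fun i _ => mul_pow _ _ _
    rw [hpow]
    ring
  rw [← ha, key]
  simp

/-- The Zariski topology on projective space: the closed sets are the projective algebraic sets. -/
@[reducible]
def projectiveZariski (K σ : Type*) [Field K] : TopologicalSpace (ℙ K (σ → K)) :=
  TopologicalSpace.ofClosed {Z | IsProjectiveAlgebraicSet Z}
    ⟨{1}, by
      rintro p rfl
      exact ⟨0, MvPolynomial.isHomogeneous_one σ K⟩, by
      ext x
      simp [projectiveZeroLocus]⟩
    (by
      intro A hA
      refine ⟨{p | (∃ d : ℕ, p.IsHomogeneous d) ∧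
        ∃ Z ∈ A, ∀ x ∈ Z, MvPolynomial.eval x.rep p = 0}, fun p hp => hp.1, ?_⟩
      ext x
      constructor
      · rintro hx p ⟨-, Z, hZ, h⟩
        exact h x (hx Z hZ)
      · intro hx Z hZ
        obtain ⟨S, hS, rfl⟩ := hA hZ
        exact fun p hp => hx p ⟨hS p hp, _, hZ, fun y hy => hy p hp⟩)
    (by
      rintro _ ⟨S, hS, rfl⟩ _ ⟨T, hT, rfl⟩
      refine ⟨{r | ∃ p ∈ S, ∃ q ∈ T, r = p * q}, ?_, ?_⟩
      · rintro _ ⟨p, hp, q, hq, rfl⟩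
        obtain ⟨d, hd⟩ := hS p hp
        obtain ⟨e, he⟩ := hT q hq
        exact ⟨d + e, hd.mul he⟩
      · ext x
        constructor
        · rintro (hx | hx) _ ⟨p, hp, q, hq, rfl⟩
          · simp [hx p hp]
          · simp [hx q hq]
        · intro hx
          by_contra hcon
          simp only [Set.mem_union, not_or, projectiveZeroLocus, Set.mem_ofPred_eq, not_forall]
            at hcon
          obtain ⟨⟨p, hp, hp0⟩, q, hq, hq0⟩ := hcon
          have := hx _ ⟨p, hp, q, hq, rfl⟩
          rw [map_mul, mul_eq_zero] at this
          exact this.elim hp0 hq0)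

/-- The projective principal minor map `φ`. Its coordinate at `I ⊆ [n]` is the maximal minor of the
`n × 2n` matrix `(A, B)` with columns `I` from `A` and columns `[n] \ I` from `B`, each column
standing in its own position, so that for `B = 1` one gets the principal minors of `A`. -/
noncomputable def principalMinorMap (n : ℕ) (A B : Matrix (Fin n) (Fin n) ℂ) :
    Finset (Fin n) → ℂ :=
  fun I => (Matrix.of fun i j => if j ∈ I then A i j else B i j).det

/-- The image `V_n` of the projective principal minor map in `ℙ^(2^n - 1)`, the projective space
with homogeneous coordinates indexed by the subsets of `[n]`. -/
def principalMinorVariety (n : ℕ) : Set (ℙ ℂ (Finset (Fin n) → ℂ)) :=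
  {x | ∃ (A B : Matrix (Fin n) (Fin n) ℂ) (h : principalMinorMap n A B ≠ 0),
    x = Projectivization.mk ℂ (principalMinorMap n A B) h}

/-! Closedness reduces to the chart `B = 1`: swapping columns between `A` and `B` permutes the
coordinates, so a nonzero coordinate can be moved to `∅` and scaled to 1. If `y` satisfies every
relation among principal minors but is attained by no matrix, the Nullstellensatz writes 1 as a
combination of the `genericMinor I - y I`. Taking parts of weight zero under diagonal conjugation
makes the coefficients invariant. Choose a valuation that is at most 1 on the ring generated by the
minors and less than 1 on each `genericMinor I - y I`. By `valuation_edgeMonomial_le_one` it is at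
most 1 on all invariants, whence `v 1 < 1`, a contradiction. The combinatorial core is
`valuation_prod_le_one`: bounded principal minors force bounded cycle products. Irreducibility holds
because the relations are the kernel of a map into a domain. -/

/-! ### Balanced multigraphs and their cycles -/

section Balanced

variable {ι : Type*} [Fintype ι] [DecidableEq ι]

/-- An edge multiplicity function on `ι` is balanced if at every vertex the in-degree and the
out-degree agree. The number `e i j` is the multiplicity of the edge `j → i`. -/
def IsBalanced (e : ι → ι → ℕ) : Prop :=
  ∀ j, ∑ i, e i j = ∑ i, e j i

/-- The edges `j → f j` with `j ∈ J`. -/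
def graphOn (J : Finset ι) (f : ι → ι) : ι → ι → ℕ :=
  fun i j => if j ∈ J ∧ i = f j then 1 else 0

/-- The monomial in the entries of `w` with exponents `e`. -/
def edgeMonomial {R : Type*} [CommMonoid R] (w : ι → ι → R) (e : ι → ι → ℕ) : R :=
  ∏ i, ∏ j, w i j ^ e i j

-- Iterating `f` shrinks the finite set `V` until it stabilises on a nonempty set that `f` permutes.
omit [Fintype ι] in
theorem exists_image_eq_self (V : Finset ι) (hV : V.Nonempty) (f : ι → ι)
    (hf : ∀ j ∈ V, f j ∈ V) : ∃ J ⊆ V, J.Nonempty ∧ J.image f = J := by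
  induction V using Finset.strongInduction with
  | H V ih =>
    have hsub : V.image f ⊆ V := Finset.image_subset_iff.2 hf
    by_cases h : V.image f = V
    · exact ⟨V, subset_rfl, hV, h⟩
    · obtain ⟨J, hJ, hne, hJf⟩ := ih (V.image f) (hsub.ssubset_of_ne h) (hV.image f)
        (fun j hj => Finset.mem_image_of_mem f (hsub hj))
      exact ⟨J, hJ.trans hsub, hne, hJf⟩

omit [Fintype ι] in
theorem injOn_of_image_eq_self {J : Finset ι} {f : ι → ι} (h : J.image f = J) :
    Set.InjOn f J :=
  Finset.card_image_iff.1 (by rw [h])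

theorem isBalanced_graphOn {J : Finset ι} {f : ι → ι} (h : J.image f = J) :
    IsBalanced (graphOn J f) := by
  intro j
  have h1 : ∑ i, graphOn J f i j = if j ∈ J then 1 else 0 := by
    by_cases hj : j ∈ J <;> simp [graphOn, hj]
  have h2 : ∑ k, graphOn J f j k = if j ∈ J then 1 else 0 := by
    simp only [graphOn, Finset.sum_boole, Nat.cast_id]
    split_ifs with hj
    · rw [← h] at hj
      obtain ⟨k, hk, rfl⟩ := Finset.mem_image.1 hj
      rw [Finset.card_eq_one]
      refine ⟨k, ?_⟩
      ext l
      simp only [Finset.mem_filter, Finset.mem_univ, true_and, Finset.mem_singleton]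
      refine ⟨fun hl => injOn_of_image_eq_self h hl.1 hk hl.2.symm, ?_⟩
      rintro rfl
      exact ⟨hk, rfl⟩
    · rw [Finset.card_eq_zero, Finset.filter_eq_empty_iff]
      rintro k - ⟨hk, rfl⟩
      exact hj (h ▸ Finset.mem_image_of_mem f hk)
  rw [h1, h2]

theorem sum_graphOn (J : Finset ι) (f : ι → ι) : ∑ i, ∑ j, graphOn J f i j = J.card := by
  rw [Finset.sum_comm]
  have (j : ι) : ∑ i, graphOn J f i j = if j ∈ J then 1 else 0 := by
    by_cases hj : j ∈ J <;> simp [graphOn, hj]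
  simp [this]

theorem edgeMonomial_graphOn {R : Type*} [CommMonoid R] (w : ι → ι → R) (J : Finset ι)
    (f : ι → ι) : edgeMonomial w (graphOn J f) = ∏ j ∈ J, w (f j) j := by
  rw [edgeMonomial, Finset.prod_comm, ← Finset.prod_subset J.subset_univ]
  · refine Finset.prod_congr rfl fun j hj => ?_
    rw [Finset.prod_eq_single (f j)] <;> simp +contextual [graphOn, hj]
  · intro j _ hj
    simp [graphOn, hj]

omit [DecidableEq ι] in
theorem edgeMonomial_add {R : Type*} [CommMonoid R] (w : ι → ι → R) (e e' : ι → ι → ℕ) :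
    edgeMonomial w (e + e') = edgeMonomial w e * edgeMonomial w e' := by
  simp [edgeMonomial, pow_add, Finset.prod_mul_distrib]

omit [DecidableEq ι] in
theorem IsBalanced.add {e e' : ι → ι → ℕ} (h : IsBalanced e) (h' : IsBalanced e') :
    IsBalanced (e + e') := by
  intro j
  simp [Finset.sum_add_distrib, h j, h' j]

omit [DecidableEq ι] in
theorem IsBalanced.of_add {e e' : ι → ι → ℕ} (h : IsBalanced (e + e')) (h' : IsBalanced e') :
    IsBalanced e := by
  intro j
  have := h j
  simp only [Pi.add_apply, Finset.sum_add_distrib, h' j] at this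
  exact Nat.add_right_cancel this

omit [Fintype ι] in
theorem exists_eq_add_graphOn {e : ι → ι → ℕ} {J : Finset ι} {f : ι → ι}
    (h : ∀ j ∈ J, e (f j) j ≠ 0) : ∃ e', e = e' + graphOn J f := by
  refine ⟨e - graphOn J f, (tsub_add_cancel_of_le fun i j => ?_).symm⟩
  simp only [graphOn]
  split_ifs with hij
  · obtain ⟨hj, rfl⟩ := hij
    exact Nat.one_le_iff_ne_zero.2 (h j hj)
  · exact Nat.zero_le _

/-- A nonzero balanced multigraph contains a nonempty disjoint union of cycles. -/
theorem IsBalanced.exists_graphOn {e : ι → ι → ℕ} (h : IsBalanced e) (he : e ≠ 0) :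
    ∃ (J : Finset ι) (f : ι → ι), J.Nonempty ∧ J.image f = J ∧ ∀ j ∈ J, e (f j) j ≠ 0 := by
  classical
  let V : Finset ι := Finset.univ.filter fun j => ∃ i, e i j ≠ 0
  have hV : V.Nonempty := by
    by_contra hcon
    apply he
    ext i j
    by_contra hij
    exact hcon ⟨j, by simpa [V] using ⟨i, hij⟩⟩
  have hex (j : ι) : ∃ i, j ∈ V → e i j ≠ 0 := by
    by_cases hj : j ∈ V
    · obtain ⟨i, hi⟩ := (Finset.mem_filter.1 hj).2
      exact ⟨i, fun _ => hi⟩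
    · exact ⟨j, fun hj' => absurd hj' hj⟩
  choose f hf using hex
  -- `f` follows an outgoing edge; its endpoint has an incoming edge, hence by balance an outgoing
  -- one.
  obtain ⟨J, hJ, hne, hJf⟩ := exists_image_eq_self V hV f fun j hj => by
    by_contra hcon
    have h0 : ∑ i, e i (f j) = 0 := Finset.sum_eq_zero fun i _ => by
      by_contra hi
      exact hcon (by simpa [V] using ⟨i, hi⟩)
    rw [h (f j), Finset.sum_eq_zero_iff] at h0
    exact hf j hj (h0 j (Finset.mem_univ j))
  exact ⟨J, f, hne, hJf, fun j hj => hf j (hJ hj)⟩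

/-- Every balanced multigraph is a sum of disjoint unions of cycles. -/
theorem IsBalanced.induction {P : (ι → ι → ℕ) → Prop} (zero : P 0)
    (add : ∀ e (J : Finset ι) (f : ι → ι), J.Nonempty → J.image f = J → P e →
      P (e + graphOn J f)) {e : ι → ι → ℕ} (he : IsBalanced e) : P e := by
  induction hN : ∑ i, ∑ j, e i j using Nat.strong_induction_on generalizing e with
  | _ N ih =>
    by_cases h0 : e = 0
    · rwa [h0]
    · obtain ⟨J, f, hne, hJf, hpos⟩ := he.exists_graphOn h0
      obtain ⟨e', rfl⟩ := exists_eq_add_graphOn hpos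
      refine add e' J f hne hJf (ih _ ?_ (he.of_add (isBalanced_graphOn hJf)) rfl)
      simp only [Pi.add_apply, Finset.sum_add_distrib, sum_graphOn] at hN
      have := hne.card_pos
      omega

variable {Γ : Type*} [LinearOrderedCommGroupWithZero Γ]

/-- With fewer than `2 * I.card` edges, a decomposition into cycle unions has at most one piece
using all of `I`; it costs a factor `M`, every other piece at most 1. -/
theorem edgeMonomial_le_of_card_lt {w : ι → ι → Γ} {I : Finset ι} {M : Γ} (hM : 1 ≤ M)
    (hlt : ∀ (J : Finset ι) (f : ι → ι), J.card < I.card → J.image f = J →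
      ∏ j ∈ J, w (f j) j ≤ 1)
    (hI : ∀ f : ι → ι, I.image f = I → ∏ j ∈ I, w (f j) j ≤ M)
    {e : ι → ι → ℕ} (he : IsBalanced e) (hsupp : ∀ i j, e i j ≠ 0 → j ∈ I)
    (hcard : ∑ i, ∑ j, e i j < 2 * I.card) : edgeMonomial w e ≤ M := by
  suffices H : (∀ i j, e i j ≠ 0 → j ∈ I) →
      (∑ i, ∑ j, e i j < I.card → edgeMonomial w e ≤ 1) ∧
      (∑ i, ∑ j, e i j < 2 * I.card → edgeMonomial w e ≤ M) from (H hsupp).2 hcard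
  clear hcard hsupp
  refine he.induction (P := fun e => (∀ i j, e i j ≠ 0 → j ∈ I) →
      (∑ i, ∑ j, e i j < I.card → edgeMonomial w e ≤ 1) ∧
      (∑ i, ∑ j, e i j < 2 * I.card → edgeMonomial w e ≤ M)) ?_ ?_
  · intro _
    simp [edgeMonomial, hM]
  · intro e J f hne hJf ih hsupp
    obtain ⟨ih1, ih2⟩ := ih fun i j hij => hsupp i j (by simp [hij])
    have hJI : J ⊆ I := fun j hj => hsupp (f j) j (by simp [graphOn, hj])
    have hpos := hne.card_pos
    simp only [Pi.add_apply, Finset.sum_add_distrib, sum_graphOn, edgeMonomial_add,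
      edgeMonomial_graphOn]
    refine ⟨fun h => mul_le_one' (ih1 (by omega)) (hlt J f (by omega) hJf), fun h => ?_⟩
    rcases (Finset.card_le_card hJI).lt_or_eq with hc | hc
    · exact (mul_le_mul' (ih2 (by omega)) (hlt J f hc hJf)).trans (mul_one M).le
    · obtain rfl := Finset.eq_of_subset_of_card_le hJI hc.ge
      exact (mul_le_mul' (ih1 (by omega)) (hI f hJf)).trans (one_mul M).le

end Balanced

/-! ### Valuations of principal minors and cycle products -/

section Minors

variable {ι R : Type*} [Fintype ι] [DecidableEq ι] [CommRing R]

/-- The determinant of the matrix with columns `I` from `A` and the other columns from `B`. -/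
def mixedMinor (A B : Matrix ι ι R) (I : Finset ι) : R :=
  (Matrix.of fun i j => if j ∈ I then A i j else B i j).det

theorem mixedMinor_one_eq_sum (A : Matrix ι ι R) (I : Finset ι) :
    mixedMinor A 1 I = ∑ σ : Equiv.Perm ι, if ∀ j ∉ I, σ j = j then
      (Equiv.Perm.sign σ : ℤ) * ∏ j ∈ I, A (σ j) j else (0 : R) := by
  rw [mixedMinor, Matrix.det_apply']
  refine Finset.sum_congr rfl fun σ _ => ?_
  split_ifs with h
  · congr 1
    rw [← Finset.prod_subset I.subset_univ]
    · exact Finset.prod_congr rfl fun j hj => by simp [hj]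
    · intro j _ hj
      simp [hj, h j hj]
  · push Not at h
    obtain ⟨j, hj, hne⟩ := h
    rw [Finset.prod_eq_zero (Finset.mem_univ j), mul_zero]
    simp [hj, Matrix.one_apply, hne]

omit [Fintype ι] in
theorem image_perm_eq_self {σ : Equiv.Perm ι} {I : Finset ι} (h : ∀ j ∉ I, σ j = j) :
    I.image σ = I := by
  refine Finset.eq_of_subset_of_card_le (Finset.image_subset_iff.2 fun j hj => ?_)
    (Finset.card_image_of_injective I σ.injective).ge
  by_contra hcon
  exact hcon (by rwa [σ.injective (h _ hcon)])

theorem exists_perm_eqOn {I : Finset ι} {f : ι → ι} (h : I.image f = I) :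
    ∃ σ : Equiv.Perm ι, (∀ j ∉ I, σ j = j) ∧ ∀ j ∈ I, σ j = f j := by
  have hmem : ∀ j ∈ I, f j ∈ I := fun j hj => h ▸ Finset.mem_image_of_mem f hj
  have hinj : Function.Injective fun j => if j ∈ I then f j else j := by
    intro a b hab
    by_cases ha : a ∈ I <;> by_cases hb : b ∈ I <;> simp only [ha, hb, if_true, if_false] at hab
    · exact injOn_of_image_eq_self h ha hb hab
    · exact absurd (hab ▸ hmem a ha) hb
    · exact absurd (hab ▸ hmem b hb) ha
    · exact hab
  exact ⟨Equiv.ofBijective _ (Finite.injective_iff_bijective.1 hinj),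
    fun j hj => by simp [hj], fun j hj => by simp [hj]⟩

variable {K Γ : Type*} [Field K] [LinearOrderedCommGroupWithZero Γ]

/-- Induction on `I.card`. A largest term `M > 1` of the minor must be attained twice, by `σ ≠ τ`. A
smaller cycle union `J` splits off from the union of their graphs, and the rest has value at most
`M`, so `M * M ≤ M`. -/
theorem valuation_prod_le_one (v : Valuation K Γ) (A : Matrix ι ι K)
    (h : ∀ I, v (mixedMinor A 1 I) ≤ 1) (I : Finset ι) (f : ι → ι) (hf : I.image f = I) :
    ∏ j ∈ I, v (A (f j) j) ≤ 1 := by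
  induction hk : I.card using Nat.strong_induction_on generalizing I f with
  | _ k ih =>
    subst hk
    let t : Equiv.Perm ι → K := fun σ => if ∀ j ∉ I, σ j = j then
      (Equiv.Perm.sign σ : ℤ) * ∏ j ∈ I, A (σ j) j else 0
    have hsign (σ : Equiv.Perm ι) : v ((Equiv.Perm.sign σ : ℤ) : K) = 1 := by
      rcases Int.units_eq_one_or (Equiv.Perm.sign σ) with hs | hs <;> simp [hs]
    have ht (σ : Equiv.Perm ι) (hσ : ∀ j ∉ I, σ j = j) :
        v (t σ) = ∏ j ∈ I, v (A (σ j) j) := by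
      simp [t, if_pos hσ, hsign]
    obtain ⟨σ, -, hmax⟩ := Finset.exists_max_image Finset.univ (fun σ => v (t σ))
      Finset.univ_nonempty
    have hle (g : ι → ι) (hg : I.image g = I) : ∏ j ∈ I, v (A (g j) j) ≤ v (t σ) := by
      obtain ⟨ρ, hρ, hρg⟩ := exists_perm_eqOn hg
      refine le_trans (le_of_eq ?_) (hmax ρ (Finset.mem_univ ρ))
      rw [ht ρ hρ]
      exact Finset.prod_congr rfl fun j hj => by rw [hρg j hj]
    refine (hle f hf).trans ?_
    by_contra! hM
    have hfix (ρ : Equiv.Perm ι) (hρ : 1 < v (t ρ)) : ∀ j ∉ I, ρ j = j := by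
      by_contra hcon
      simp [t, if_neg hcon] at hρ
    have hσ := hfix σ hM
    -- A strictly dominant term would give the whole minor its value, which exceeds 1.
    obtain ⟨τ, hne, hτσ⟩ : ∃ τ, τ ≠ σ ∧ v (t σ) ≤ v (t τ) := by
      by_contra! hcon
      have := Valuation.map_sum_eq_of_lt v (Finset.mem_univ σ) (f := t)
        fun ρ hρ => hcon ρ (by simpa using hρ)
      have h1 := h I
      rw [mixedMinor_one_eq_sum] at h1
      exact absurd (this ▸ h1) (not_le.2 hM)
    have hτ := hfix τ (hM.trans_le hτσ)
    obtain ⟨i, hi⟩ : ∃ i, τ i ≠ σ i := by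
      by_contra! hcon
      exact hne (Equiv.ext hcon)
    have hiI : i ∈ I := by
      by_contra hcon
      exact hi ((hτ i hcon).trans (hσ i hcon).symm)
    have hσI := image_perm_eq_self hσ
    have hτI := image_perm_eq_self hτ
    -- Redirecting `i` makes `g` non-injective on `I`, so the set it permutes is a proper subset.
    let g : ι → ι := Function.update σ i (τ i)
    obtain ⟨J, hJI, hJnonempty, hJg⟩ := exists_image_eq_self I ⟨i, hiI⟩ g fun j hj => by
      by_cases hji : j = i
      · subst hji
        simpa [g] using hτI ▸ Finset.mem_image_of_mem τ hiI
      · simpa [g, hji] using hσI ▸ Finset.mem_image_of_mem σ hj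
    have hJne : J ≠ I := by
      rintro rfl
      obtain ⟨k, hk, hki⟩ := Finset.mem_image.1 (hσI.symm ▸ hτI ▸ Finset.mem_image_of_mem τ hiI :
        τ i ∈ J.image σ)
      have hne' : k ≠ i := by
        rintro rfl
        exact hi hki.symm
      exact hne' (injOn_of_image_eq_self hJg hk hiI (by simp [g, hne', hki]))
    have hJlt : J.card < I.card := Finset.card_lt_card (hJI.ssubset_of_ne hJne)
    obtain ⟨e, he⟩ := exists_eq_add_graphOn (e := graphOn I σ + graphOn I τ) (J := J) (f := g)
      fun j hj => by
        by_cases hji : j = i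
        · subst hji
          simp [graphOn, g, hiI]
        · simp [graphOn, g, hji, hJI hj]
    have hbal : IsBalanced e := IsBalanced.of_add
      (he ▸ (isBalanced_graphOn hσI).add (isBalanced_graphOn hτI)) (isBalanced_graphOn hJg)
    have hJpos := hJnonempty.card_pos
    have hsum : ∑ i, ∑ j, e i j + J.card = 2 * I.card := by
      have := congrArg (fun e : ι → ι → ℕ => ∑ i, ∑ j, e i j) he
      simp only [Pi.add_apply, Finset.sum_add_distrib, sum_graphOn] at this
      omega
    have hmon := congrArg (edgeMonomial fun i j => v (A i j)) he
    simp only [edgeMonomial_add, edgeMonomial_graphOn] at hmon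
    rw [← ht σ hσ, ← ht τ hτ, le_antisymm (hmax τ (Finset.mem_univ τ)) hτσ] at hmon
    have hbound : edgeMonomial (fun i j => v (A i j)) e ≤ v (t σ) :=
      edgeMonomial_le_of_card_lt hM.le (fun J f hc hJf => ih J.card hc J f hJf rfl) hle hbal
        (fun a b hab => by
          by_contra hb
          have := congrFun₂ he a b
          simp [graphOn, hb] at this
          omega) (by omega)
    have hfin : v (t σ) * v (t σ) ≤ v (t σ) * 1 :=
      hmon.le.trans (mul_le_mul' hbound (ih J.card hJlt J g hJg rfl))
    exact absurd (le_of_mul_le_mul_left hfin (zero_lt_one.trans hM)) (not_le.2 hM)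

/-- If a valuation is at most one on the principal minors of a matrix, then it is at most one on
all monomials in the entries that are invariant under diagonal conjugation. -/
theorem valuation_edgeMonomial_le_one (v : Valuation K Γ) (A : Matrix ι ι K)
    (h : ∀ I, v (mixedMinor A 1 I) ≤ 1) {e : ι → ι → ℕ} (he : IsBalanced e) :
    v (edgeMonomial (fun i j => A i j) e) ≤ 1 := by
  refine he.induction (P := fun e => v (edgeMonomial (fun i j => A i j) e) ≤ 1) ?_ ?_
  · simp [edgeMonomial]
  · intro e J f _ hJf ih
    rw [edgeMonomial_add, edgeMonomial_graphOn, map_mul, map_prod]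
    exact mul_le_one' ih (valuation_prod_le_one v A h J f hJf)

end Minors

/-! ### The affine principal minor map has closed image -/

section AffineImage

open MvPolynomial

variable {ι : Type*} [Fintype ι] [DecidableEq ι]

theorem map_mixedMinor {R S : Type*} [CommRing R] [CommRing S] (f : R →+* S)
    (A B : Matrix ι ι R) (I : Finset ι) :
    f (mixedMinor A B I) = mixedMinor (f.mapMatrix A) (f.mapMatrix B) I := by
  rw [mixedMinor, RingHom.map_det, mixedMinor]
  congr 1
  ext i j
  by_cases hj : j ∈ I <;> simp [hj]

/-- The weight of the matrix entry `(i, j)` under conjugation by diagonal matrices. -/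
def conjWeight (p : ι × ι) : ι → ℤ :=
  Pi.single p.2 1 - Pi.single p.1 1

theorem isBalanced_of_weight_eq_zero {d : ι × ι →₀ ℕ} (h : Finsupp.weight conjWeight d = 0) :
    IsBalanced fun i j => d (i, j) := by
  intro j
  have := congrFun h j
  rw [Finsupp.weight_apply, Finsupp.sum_fintype _ _ (by simp)] at this
  simp only [Fintype.sum_prod_type, conjWeight, Finset.sum_apply, Pi.smul_apply, Pi.sub_apply,
    Pi.single_apply, smul_sub, Finset.sum_sub_distrib, Pi.zero_apply, smul_ite, smul_zero,
    Finset.sum_ite_eq, Finset.mem_univ, if_true] at this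
  rw [sub_eq_zero, Finset.sum_comm (f := fun x y => if j = x then _ else _)] at this
  simp only [Finset.sum_ite_eq, Finset.mem_univ, if_true] at this
  exact_mod_cast (by simpa using this : ∑ i, (d (i, j) : ℤ) = ∑ i, (d (j, i) : ℤ))

variable (ι) (k : Type*) [Field k]

/-- The principal minors of the generic matrix. -/
noncomputable def genericMinor (I : Finset ι) : MvPolynomial (ι × ι) k :=
  mixedMinor (Matrix.mvPolynomialX ι ι k) 1 I

variable {ι k}

theorem isWeightedHomogeneous_genericMinor (I : Finset ι) :
    IsWeightedHomogeneous conjWeight (genericMinor ι k I) 0 := by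
  rw [genericMinor, mixedMinor_one_eq_sum]
  refine IsWeightedHomogeneous.sum _ _ _ fun σ _ => ?_
  split_ifs with hσ
  · have hprod : IsWeightedHomogeneous conjWeight
        (∏ j ∈ I, Matrix.mvPolynomialX ι ι k (σ j) j) (∑ j ∈ I, conjWeight (σ j, j)) :=
      IsWeightedHomogeneous.prod _ _ _ fun j _ => isWeightedHomogeneous_X _ _ _
    have hzero : ∑ j ∈ I, conjWeight (σ j, j) = 0 := by
      simp only [conjWeight, Finset.sum_sub_distrib]
      rw [sub_eq_zero]
      conv_lhs => rw [← image_perm_eq_self hσ]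
      rw [Finset.sum_image σ.injective.injOn]
    rw [hzero] at hprod
    have := hprod.C_mul ((Equiv.Perm.sign σ : ℤ) : k)
    rwa [map_intCast] at this
  · exact isWeightedHomogeneous_zero _ _ _

/-- The weight-zero projection plays the role of a Reynolds operator: it is linear over the
invariants. -/
theorem weightedHomogeneousComponent_zero_mul_of_left {R σ M : Type*} [CommSemiring R]
    [AddCommMonoid M] {w : σ → M} {a : MvPolynomial σ R} (ha : IsWeightedHomogeneous w a 0)
    (b : MvPolynomial σ R) :
    weightedHomogeneousComponent w 0 (a * b) = a * weightedHomogeneousComponent w 0 b := by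
  classical
  let := weightedGradedAlgebra R w
  simp only [← weightedDecomposition.decompose'_apply]
  exact DirectSum.coe_decompose_mul_of_left_mem_zero (weightedHomogeneousSubmodule R w) (j := 0)
      (b := b) ha

omit [DecidableEq ι] in
theorem algebraMap_monomial_eq {K : Type*} [CommRing K] [Algebra (MvPolynomial (ι × ι) k) K]
    (d : ι × ι →₀ ℕ) (a : k) :
    algebraMap (MvPolynomial (ι × ι) k) K (monomial d a) =
      algebraMap (MvPolynomial (ι × ι) k) K (C a) *
        edgeMonomial (fun i j => algebraMap (MvPolynomial (ι × ι) k) K (X (i, j)))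
          fun i j => d (i, j) := by
  rw [monomial_eq, map_mul, Finsupp.prod_fintype _ _ (by simp), map_prod, edgeMonomial,
    Fintype.prod_prod_type]
  simp

/-- A family satisfying all polynomial relations among the principal minors consists of the
principal minors of a matrix: the image of the affine principal minor map is Zariski closed. -/
theorem exists_mixedMinor_one_eq [IsAlgClosed k] (y : Finset ι → k)
    (hy : ∀ F : MvPolynomial (Finset ι) k, aeval (genericMinor ι k) F = 0 → eval y F = 0) :
    ∃ A : Matrix ι ι k, ∀ I, mixedMinor A 1 I = y I := by
  by_contra! hno
  have htop : Ideal.span (Set.range fun I => genericMinor ι k I - C (y I)) = ⊤ := by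
    by_contra hne
    obtain ⟨m, hm, hle⟩ := Ideal.exists_le_maximal _ hne
    obtain ⟨x, rfl⟩ := eq_vanishingIdeal_singleton_of_isMaximal k hm
    obtain ⟨I, hI⟩ := hno (Matrix.of fun i j => x (i, j))
    have h0 := (mem_vanishingIdeal_singleton_iff x _).1
      (hle (Ideal.subset_span (Set.mem_range_self I)))
    rw [map_sub, sub_eq_zero, genericMinor, ← AlgHom.coe_toRingHom, map_mixedMinor] at h0
    apply hI
    convert! h0 using 1
    · congr 1
      · ext i j
        simp
      · simp
    · simp
  obtain ⟨c, hc⟩ := Ideal.mem_span_range_iff_exists_fun.1 ((Ideal.eq_top_iff_one _).1 htop)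
  have hw (I : Finset ι) :
      IsWeightedHomogeneous conjWeight (genericMinor ι k I - C (y I)) 0 :=
    (isWeightedHomogeneous_genericMinor I).sub (isWeightedHomogeneous_C _ _)
  have hc0 := congrArg (weightedHomogeneousComponent (conjWeight (ι := ι)) 0) hc
  rw [(isWeightedHomogeneous_one k _).weightedHomogeneousComponent_same, map_sum] at hc0
  simp only [mul_comm (c _), weightedHomogeneousComponent_zero_mul_of_left (hw _)] at hc0
  let K := FractionRing (MvPolynomial (ι × ι) k)
  let θ : MvPolynomial (ι × ι) k →+* K := algebraMap _ _
  let ψ : MvPolynomial (Finset ι) k →+* K := θ.comp (aeval (genericMinor ι k)).toRingHom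
  have hθ : Function.Injective θ := IsFractionRing.injective _ _
  -- If `F` vanishes at `y` but becomes 1 on the generic minors, then `F - 1` is a relation with
  -- value `-1` at `y`.
  have hproper : (RingHom.ker (eval y)).map ψ.rangeRestrict ≠ ⊤ := by
    rw [Ne, Ideal.eq_top_iff_one,
      Ideal.mem_map_iff_of_surjective _ ψ.rangeRestrict_surjective]
    rintro ⟨F, hF, h1⟩
    have h1' : θ (aeval (genericMinor ι k) F) = 1 := congrArg Subtype.val h1
    have h2 := hy (F - 1) (by
      rw [map_sub, map_one, sub_eq_zero]
      exact hθ (by rw [h1', map_one]))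
    rw [map_sub, (RingHom.mem_ker).1 hF, map_one] at h2
    simp at h2
  -- The valuation ring contains the ring of minors, and the ideal of `y` lands in its nonunits.
  obtain ⟨V, hV, hVm⟩ := Ideal.image_subset_nonunits_valuationSubring _ hproper
  have hψ (F : MvPolynomial (Finset ι) k) : V.valuation (ψ F) ≤ 1 :=
    (V.valuation_le_one_iff _).2 (hV ⟨F, rfl⟩)
  have hlt (I : Finset ι) : V.valuation (θ (genericMinor ι k I - C (y I))) < 1 := by
    rw [← V.mem_nonunits_iff]
    refine hVm ⟨ψ.rangeRestrict (X I - C (y I)), Ideal.mem_map_of_mem _ ?_, ?_⟩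
    · simp [RingHom.mem_ker]
    · change θ (aeval (genericMinor ι k) (X I - C (y I))) = _
      simp [algebraMap_eq]
  have hminor (I : Finset ι) :
      V.valuation (mixedMinor (Matrix.of fun i j => θ (X (i, j))) 1 I) ≤ 1 := by
    convert! hψ (X I)
    simp only [ψ, genericMinor, RingHom.comp_apply, AlgHom.toRingHom_eq_coe, RingHom.coe_coe,
      aeval_X, map_mixedMinor]
    congr 1
    · simp
  have hinv (p : MvPolynomial (ι × ι) k) :
      V.valuation (θ (weightedHomogeneousComponent conjWeight 0 p)) ≤ 1 := by
    classical
    rw [weightedHomogeneousComponent_apply, map_sum]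
    refine Valuation.map_sum_le _ fun d hd => ?_
    rw [algebraMap_monomial_eq, map_mul]
    refine mul_le_one' ?_ (valuation_edgeMonomial_le_one V.valuation _ hminor
      (isBalanced_of_weight_eq_zero (Finset.mem_filter.1 hd).2))
    simpa [ψ, algebraMap_eq] using hψ (C (coeff d p))
  have hone : V.valuation (θ 1) < 1 := by
    rw [← hc0, map_sum]
    refine Valuation.map_sum_lt _ one_ne_zero fun I _ => ?_
    rw [map_mul, map_mul]
    exact mul_lt_one_of_lt_of_le (hlt I) (hinv _)
  simp at hone

end AffineImage

/-! ### From the affine chart to all mixed minors -/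

section ProjectiveImage

open MvPolynomial

variable {ι : Type*} [Fintype ι] [DecidableEq ι]

theorem mixedMinor_mul_left {R : Type*} [CommRing R] (P A B : Matrix ι ι R) (I : Finset ι) :
    mixedMinor (P * A) (P * B) I = P.det * mixedMinor A B I := by
  rw [mixedMinor, mixedMinor, ← Matrix.det_mul]
  congr 1
  ext i j
  by_cases hj : j ∈ I <;> simp [Matrix.mul_apply, hj]

theorem mixedMinor_empty {R : Type*} [CommRing R] (A B : Matrix ι ι R) :
    mixedMinor A B ∅ = B.det := by
  simp [mixedMinor]
  rfl

/-- Exchanging the columns in `T` between `A` and `B` translates the mixed minors by `T`. -/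
theorem mixedMinor_swap {R : Type*} [CommRing R] (A B : Matrix ι ι R) (T I : Finset ι) :
    mixedMinor (Matrix.of fun i j => if j ∈ T then B i j else A i j)
      (Matrix.of fun i j => if j ∈ T then A i j else B i j) I =
      mixedMinor A B (symmDiff I T) := by
  rw [mixedMinor, mixedMinor]
  congr 1
  ext i j
  by_cases hI : j ∈ I <;> by_cases hT : j ∈ T <;> simp [hI, hT, Finset.mem_symmDiff]

theorem eval_smul_of_isHomogeneous {R σ : Type*} [CommRing R] {p : MvPolynomial σ R} {d : ℕ}
    (hp : p.IsHomogeneous d) (a : R) (v : σ → R) : eval (a • v) p = a ^ d * eval v p := by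
  rw [eval_eq, eval_eq, Finset.mul_sum]
  refine Finset.sum_congr rfl fun m hm => ?_
  have hdeg : ∑ i ∈ m.support, m i = d := by
    rw [← hp.degree_eq_sum_deg_support hm]
  rw [← hdeg, ← Finset.prod_pow_eq_pow_sum, mul_left_comm, ← Finset.prod_mul_distrib]
  exact congrArg _ (Finset.prod_congr rfl fun i _ => mul_pow _ _ _)

/-- Homogenization with respect to the variable `s`, multiplied by `s`. -/
theorem exists_isHomogeneous_eval_eq {R σ : Type*} [CommRing R] (s : σ) (G : MvPolynomial σ R) :
    ∃ (F : MvPolynomial σ R) (d : ℕ), F.IsHomogeneous d ∧ (∀ z, z s = 0 → eval z F = 0) ∧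
      ∀ z, z s = 1 → eval z F = eval z G := by
  refine ⟨∑ i ∈ Finset.range (G.totalDegree + 1),
    X s ^ (G.totalDegree + 1 - i) * homogeneousComponent i G, G.totalDegree + 1, ?_, ?_, ?_⟩
  · refine IsHomogeneous.sum _ _ _ fun i hi => ?_
    have := (isHomogeneous_X_pow (R := R) s (G.totalDegree + 1 - i)).mul
      (homogeneousComponent_isHomogeneous i G)
    rwa [Nat.sub_add_cancel (Finset.mem_range.1 hi).le] at this
  · intro z hz
    rw [map_sum]
    refine Finset.sum_eq_zero fun i hi => ?_
    have := Finset.mem_range.1 hi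
    rw [map_mul, map_pow, eval_X, hz, zero_pow (by omega), zero_mul]
  · intro z hz
    conv_rhs => rw [← sum_homogeneousComponent G]
    simp [hz]

variable {k : Type*} [Field k]

theorem eval_aeval_genericMinor (A : Matrix ι ι k) (G : MvPolynomial (Finset ι) k) :
    eval (fun p : ι × ι => A p.1 p.2) (aeval (genericMinor ι k) G) =
      eval (mixedMinor A 1) G := by
  have h : (fun I => eval (fun p : ι × ι => A p.1 p.2) (genericMinor ι k I)) =
      mixedMinor A 1 := by
    ext I
    rw [genericMinor, map_mixedMinor]
    congr 1
    · ext i j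
      simp
    · simp
  rw [← h]
  induction G using MvPolynomial.induction_on with
  | C a => simp [algebraMap_eq]
  | add p q hp hq => simp only [map_add, hp, hq]
  | mul_X p i hp => simp only [map_mul, hp, aeval_X, eval_X]

theorem exists_mixedMinor_eq_of_apply_empty [IsAlgClosed k] (y : Finset ι → k) (hy : y ∅ = 1)
    (h : ∀ (F : MvPolynomial (Finset ι) k) (d : ℕ), F.IsHomogeneous d →
      (∀ A B : Matrix ι ι k, eval (mixedMinor A B) F = 0) → eval y F = 0) :
    ∃ A : Matrix ι ι k, ∀ I, mixedMinor A 1 I = y I := by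
  refine exists_mixedMinor_one_eq y fun G hG => ?_
  obtain ⟨F, d, hF, hF0, hF1⟩ := exists_isHomogeneous_eval_eq ∅ G
  rw [← hF1 y hy]
  refine h F d hF fun A B => ?_
  -- The extra factor `X ∅` in the homogenization handles singular `B`; otherwise left
  -- multiplication by `B⁻¹` reduces to the chart.
  by_cases hB : B.det = 0
  · exact hF0 _ (by rw [mixedMinor_empty, hB])
  · have hscale : mixedMinor A B = B.det • mixedMinor (B⁻¹ * A) 1 := by
      ext I
      rw [Pi.smul_apply, smul_eq_mul, ← mixedMinor_mul_left, mul_one,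
        Matrix.mul_nonsing_inv_cancel_left _ _ (Ne.isUnit hB)]
    rw [hscale, eval_smul_of_isHomogeneous hF, hF1 _ (by simp [mixedMinor_empty]),
      ← eval_aeval_genericMinor, hG, map_zero, mul_zero]

/-- Up to a scalar, a nonzero vector satisfying all homogeneous relations among the mixed minors
is a vector of mixed minors. -/
theorem exists_mixedMinor_eq_smul [IsAlgClosed k] (y : Finset ι → k) (hy : y ≠ 0)
    (h : ∀ (F : MvPolynomial (Finset ι) k) (d : ℕ), F.IsHomogeneous d →
      (∀ A B : Matrix ι ι k, eval (mixedMinor A B) F = 0) → eval y F = 0) :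
    ∃ (A B : Matrix ι ι k) (c : k), c ≠ 0 ∧ mixedMinor A B = c • y := by
  obtain ⟨T, hT⟩ := Function.ne_iff.1 hy
  have hT : y T ≠ 0 := hT
  obtain ⟨A, hA⟩ := exists_mixedMinor_eq_of_apply_empty ((y T)⁻¹ • fun I => y (symmDiff I T))
    (by simp [← Finset.bot_eq_empty, bot_symmDiff, hT]) fun F d hF hvan => by
      rw [eval_smul_of_isHomogeneous hF]
      have := h (rename (fun I => symmDiff I T) F) d
        (hF.rename_isHomogeneous) fun A B => by
          rw [eval_rename, ← hvan (Matrix.of fun i j => if j ∈ T then B i j else A i j)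
            (Matrix.of fun i j => if j ∈ T then A i j else B i j)]
          congr 2
          ext I
          rw [Function.comp_apply, mixedMinor_swap]
      rw [eval_rename] at this
      exact mul_eq_zero_of_right _ this
  refine ⟨_, _, (y T)⁻¹, inv_ne_zero hT, funext fun I => (mixedMinor_swap A 1 T I).trans ?_⟩
  rw [hA]
  simp [symmDiff_symmDiff_cancel_right]

end ProjectiveImage

/-! ### Closedness and irreducibility in projective space -/

section Projective

open MvPolynomial

theorem isClosed_projectiveZariski_iff {K σ : Type*} [Field K] {Z : Set (ℙ K (σ → K))} :
    IsClosed[projectiveZariski K σ] Z ↔ IsProjectiveAlgebraicSet Z := by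
  rw [← @isOpen_compl_iff]
  change IsProjectiveAlgebraicSet Zᶜᶜ ↔ _
  rw [compl_compl]

theorem isProjectiveAlgebraicSet_principalMinorVariety (n : ℕ) :
    IsProjectiveAlgebraicSet (principalMinorVariety n) := by
  let S : Set (MvPolynomial (Finset (Fin n)) ℂ) := {F | (∃ d : ℕ, F.IsHomogeneous d) ∧
    ∀ A B : Matrix (Fin n) (Fin n) ℂ, eval (mixedMinor A B) F = 0}
  have hS : ∀ F ∈ S, ∃ d : ℕ, F.IsHomogeneous d := fun F hF => hF.1
  refine ⟨S, hS, Set.Subset.antisymm ?_ ?_⟩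
  · rintro _ ⟨A, B, h, rfl⟩
    rw [projectiveZeroLocus_mk hS]
    exact fun F hF => hF.2 A B
  · intro x hx
    induction x using Projectivization.ind with
    | h v hv =>
      rw [projectiveZeroLocus_mk hS] at hx
      obtain ⟨A, B, c, hc, hAB⟩ := exists_mixedMinor_eq_smul v hv
        fun F d hF hvan => hx F ⟨⟨d, hF⟩, hvan⟩
      have hAB : principalMinorMap n A B = c • v := hAB
      refine ⟨A, B, by rw [hAB]; exact smul_ne_zero hc hv, ?_⟩
      rw [Projectivization.mk_eq_mk_iff']
      exact ⟨c⁻¹, by rw [hAB, inv_smul_smul₀ hc]⟩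

/-- The mixed minors of a pair of generic matrices. -/
noncomputable def genericMixedMinor (n : ℕ) (I : Finset (Fin n)) :
    MvPolynomial (Bool × Fin n × Fin n) ℂ :=
  mixedMinor (Matrix.of fun i j => X (true, i, j)) (Matrix.of fun i j => X (false, i, j)) I

theorem eval_aeval_genericMixedMinor {n : ℕ} (x : Bool × Fin n × Fin n → ℂ)
    (G : MvPolynomial (Finset (Fin n)) ℂ) :
    eval x (aeval (genericMixedMinor n) G) =
      eval (principalMinorMap n (Matrix.of fun i j => x (true, i, j))
        (Matrix.of fun i j => x (false, i, j))) G := by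
  have h : (fun I => eval x (genericMixedMinor n I)) =
      principalMinorMap n (Matrix.of fun i j => x (true, i, j))
        (Matrix.of fun i j => x (false, i, j)) := by
    ext I
    rw [genericMixedMinor, map_mixedMinor]
    change mixedMinor _ _ I = mixedMinor _ _ I
    congr 1 <;> ext i j <;> simp
  rw [← h]
  induction G using MvPolynomial.induction_on with
  | C a => simp [algebraMap_eq]
  | add p q hp hq => simp only [map_add, hp, hq]
  | mul_X p i hp => simp only [map_mul, hp, aeval_X, eval_X]

theorem aeval_genericMixedMinor_ne_zero {n : ℕ} {G : MvPolynomial (Finset (Fin n)) ℂ}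
    {A B : Matrix (Fin n) (Fin n) ℂ} (h : eval (principalMinorMap n A B) G ≠ 0) :
    aeval (genericMixedMinor n) G ≠ 0 := by
  intro h0
  have := eval_aeval_genericMixedMinor
    (fun p => if p.1 then A p.2.1 p.2.2 else B p.2.1 p.2.2) G
  rw [h0, map_zero] at this
  exact h this.symm

theorem principalMinorMap_zero_one_ne_zero (n : ℕ) : principalMinorMap n 0 1 ∅ ≠ 0 := by
  change mixedMinor _ _ _ ≠ _
  simp [mixedMinor_empty]

theorem isIrreducible_principalMinorVariety (n : ℕ) :
    @IsIrreducible _ (projectiveZariski ℂ (Finset (Fin n))) (principalMinorVariety n) := by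
  have hbase := principalMinorMap_zero_one_ne_zero n
  refine ⟨⟨_, 0, 1, fun h => hbase (congrFun h ∅), rfl⟩, ?_⟩
  rw [@isPreirreducible_iff_isClosed_union_isClosed]
  intro Z₁ Z₂ hZ₁ hZ₂ hsub
  obtain ⟨S₁, hS₁, rfl⟩ := isClosed_projectiveZariski_iff.1 hZ₁
  obtain ⟨S₂, hS₂, rfl⟩ := isClosed_projectiveZariski_iff.1 hZ₂
  by_contra! hcon
  obtain ⟨hcon₁, hcon₂⟩ := hcon
  rw [Set.not_subset] at hcon₁ hcon₂
  obtain ⟨_, ⟨A₁, B₁, h₁, rfl⟩, hx₁⟩ := hcon₁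
  obtain ⟨_, ⟨A₂, B₂, h₂, rfl⟩, hx₂⟩ := hcon₂
  rw [projectiveZeroLocus_mk hS₁] at hx₁
  rw [projectiveZeroLocus_mk hS₂] at hx₂
  push Not at hx₁ hx₂
  obtain ⟨p₁, hp₁, hne₁⟩ := hx₁
  obtain ⟨p₂, hp₂, hne₂⟩ := hx₂
  -- The factor `X ∅` ensures that a point where the product is nonzero defines a projective point.
  have hprod : aeval (genericMixedMinor n) (p₁ * p₂ * X ∅) ≠ 0 := by
    rw [map_mul, map_mul]
    refine mul_ne_zero (mul_ne_zero (aeval_genericMixedMinor_ne_zero hne₁)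
      (aeval_genericMixedMinor_ne_zero hne₂))
      (aeval_genericMixedMinor_ne_zero (A := 0) (B := 1) ?_)
    rwa [eval_X]
  obtain ⟨x, hx⟩ : ∃ x, eval x (aeval (genericMixedMinor n) (p₁ * p₂ * X ∅)) ≠ 0 := by
    by_contra! hall
    exact hprod (MvPolynomial.funext fun x => by rw [hall x, map_zero])
  rw [eval_aeval_genericMixedMinor, map_mul, map_mul, eval_X] at hx
  have hne : principalMinorMap n (Matrix.of fun i j => x (true, i, j))
      (Matrix.of fun i j => x (false, i, j)) ≠ 0 :=
    fun h0 => right_ne_zero_of_mul hx (congrFun h0 ∅)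
  rcases hsub ⟨_, _, hne, rfl⟩ with hmem | hmem
  · rw [projectiveZeroLocus_mk hS₁] at hmem
    exact left_ne_zero_of_mul (left_ne_zero_of_mul hx) (hmem p₁ hp₁)
  · rw [projectiveZeroLocus_mk hS₂] at hmem
    exact right_ne_zero_of_mul (left_ne_zero_of_mul hx) (hmem p₂ hp₂)

end Projective

theorem mainTheorem5 (n : ℕ) :
    IsClosed[projectiveZariski ℂ (Finset (Fin n))] (principalMinorVariety n) ∧
      @IsIrreducible _ (projectiveZariski ℂ (Finset (Fin n))) (principalMinorVariety n) :=
  ⟨isClosed_projectiveZariski_iff.2 (isProjectiveAlgebraicSet_principalMinorVariety n),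
    isIrreducible_principalMinorVariety n⟩
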